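/- Fix a countably infinite set $\mathsf{Var}$ of propositional variables, and let $\mathcal L^{\forall}_{[d]}$ be the set of modal formulas built from the variables $p\in\mathsf{Var}$ and $\top$ by means of $\neg$, $\wedge$, the coderivative operator $[d]$ and the universal modality $\forall$. Given a topological space $X$ and an assignment $h:\mathsf{Var}\to\wp(X)$, truth of a formula at a point $x\in X$ is defined as follows: $(X,h),x\models p$ iff $x\in h(p)$; $\top$, $\neg$ and $\wedge$ are interpreted as usual; $(X,h),x\models[d]\varphi$ iff there is an open set $O\ni x$ with $(X,h),y\models\varphi$ for every $y\in O\setminus\{x\}$; and $(X,h),x\models\forall\varphi$ iff $(X,h),y\models\varphi$ for every $y\in X$. A set $\Gamma$ of formulas is satisfiable in $X$ if there are an assignment $h$ into $X$ and a point $x\in X$ such that $(X,h),x\models\varphi$ for every $\varphi\in\Gamma$, and it is finitely satisfiable in $X$ if every finite subset of $\Gamma$ is satisfiable in $X$. **Theorem.** Let $X$ be a metric space that is not compact, is $0$-dimensional (that is, T1 with a base of clopen sets), and is dense in itself (that is, no singleton is open). Then the language $\mathcal L^{\forall}_{[d]}$ is compact over $X$: every set of $\mathcal L^{\forall}_{[d]}$-formulas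 that is finitely satisfiable in $X$ is satisfiable in $X$. -/

import Mathlib

universe u

/-- Formulas of the modal language with the coderivative operator `[d]` and the universal
modality `∀`, over the countably infinite set of propositional variables `ℕ`. -/
inductive ModalFormula : Type
  | var (p : ℕ) : ModalFormula
  | top : ModalFormula
  | neg (φ : ModalFormula) : ModalFormula
  | and (φ ψ : ModalFormula) : ModalFormula
  | coderiv (φ : ModalFormula) : ModalFormula
  | univ (φ : ModalFormula) : ModalFormula

namespace ModalFormula

/-- `TrueAt h φ x` is the truth of `φ` at the point `x` of the topological model `(X, h)`,
where `h` is an assignment of subsets of `X` to the propositional variables. -/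
def TrueAt {X : Type u} [TopologicalSpace X] (h : ℕ → Set X) : ModalFormula → X → Prop
  | var p, x => x ∈ h p
  | top, _ => True
  | neg φ, x => ¬ TrueAt h φ x
  | and φ ψ, x => TrueAt h φ x ∧ TrueAt h ψ x
  | coderiv φ, x => ∃ O : Set X, IsOpen O ∧ x ∈ O ∧ ∀ y ∈ O \ {x}, TrueAt h φ y
  | univ φ, _ => ∀ y : X, TrueAt h φ y

/-- A set of formulas is satisfiable in `X` if, for some assignment into `X`, all of its
members are true at one and the same point. -/
def Satisfiable (X : Type u) [TopologicalSpace X] (Γ : Set ModalFormula) : Prop :=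
  ∃ (h : ℕ → Set X) (x : X), ∀ φ ∈ Γ, TrueAt h φ x

/-- Every finite subset is satisfiable in `X` (the assignment may depend on the subset). -/
def FinitelySatisfiable (X : Type u) [TopologicalSpace X] (Γ : Set ModalFormula) : Prop :=
  ∀ Δ : Set ModalFormula, Δ ⊆ Γ → Δ.Finite → Satisfiable X Δ

/-- The language with `[d]` and `∀` is compact over `X`. -/
def LanguageCompactOver (X : Type u) [TopologicalSpace X] : Prop :=
  ∀ Γ : Set ModalFormula, FinitelySatisfiable X Γ → Satisfiable X Γ

end ModalFormula

/-- No singleton subset is open. -/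
def DenseInItself (X : Type u) [TopologicalSpace X] : Prop :=
  ∀ x : X, ¬ IsOpen ({x} : Set X)

/-- A T1 space having a base that consists of clopen sets. -/
def ZeroDimensionalSpace (X : Type u) [TopologicalSpace X] : Prop :=
  T1Space X ∧
    ∃ B : Set (Set X), TopologicalSpace.IsTopologicalBasis B ∧ ∀ s ∈ B, IsClopen s

open Set Filter Topology TopologicalSpace

/-! Ultrafilters on pointed models act as a canonical model: a finitely satisfiable set holds at
some ultrafilter `t`, and each failing `coderiv φ` or `univ φ` has a witnessing ultrafilter. It
remains to label the points of `X` by ultrafilters so that `coderiv` is read off punctured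
neighbourhoods and `univ` off the whole space; the variables in the labels then define the
assignment.

`exists_valued_map` labels an open cell with root `t`. A closed discrete net in the cell gets label
`t`; the rest splits into open subcells accumulating at every net point, rooted at successors of
`t`, and the process repeats with finer nets (`exists_splitting`). A point escaping every net gets a
limit of the labels of its cells.

Noncompactness supplies infinitely many disjoint nonempty clopen pieces, enough to give each of the
countably many failing `univ φ` its own witness. -/

/-! ### Clopen partitions of metric spaces -/

theorem ZeroDimensionalSpace.exists_isClopen {X : Type u} [TopologicalSpace X]
    (hX : ZeroDimensionalSpace X) {z : X} {O : Set X} (hO : IsOpen O) (hz : z ∈ O) :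
    ∃ C, IsClopen C ∧ z ∈ C ∧ C ⊆ O := by
  obtain ⟨-, B, hB, hBc⟩ := hX
  obtain ⟨C, hCB, hzC, hCO⟩ := hB.exists_subset_of_mem_open hz hO
  exact ⟨C, hBc C hCB, hzC, hCO⟩

theorem DenseInItself.neBot {X : Type u} [TopologicalSpace X] (hX : DenseInItself X) (x : X) :
    (𝓝[≠] x).NeBot :=
  ⟨fun h => hX x (isOpen_singleton_iff_punctured_nhds x |>.2 h)⟩

/-- A punctured neighbourhood of `z` splits into nonempty open shells, numbered by the
naturals and converging to `z`. -/
theorem ZeroDimensionalSpace.exists_shells {X : Type u} [MetricSpace X]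
    (hX : ZeroDimensionalSpace X) (hd : DenseInItself X) {z : X} {O : Set X} (hO : IsOpen O)
    (hz : z ∈ O) :
    ∃ g : X → ℕ, (∀ x ≠ z, ∀ᶠ y in 𝓝 x, g y = g x) ∧ (∀ x ∉ O, g x = 0) ∧
      ∀ r > 0, ∀ᶠ k in atTop, ∃ x, dist x z < r ∧ x ≠ z ∧ g x = k := by
  have step : ∀ (n : ℕ) (U : {U : Set X // IsOpen U ∧ z ∈ U}),
      ∃ C : {U : Set X // IsOpen U ∧ z ∈ U}, IsClosed C.1 ∧ C.1 ⊆ U.1 ∧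
        C.1 ⊆ Metric.ball z (1 / ((n : ℝ) + 1)) ∧ ∃ p ∈ U.1, p ∉ C.1 := by
    rintro n ⟨U, hU, hzU⟩
    have := hd.neBot z
    obtain ⟨p, hpU, hpz⟩ : ∃ p, p ∈ U ∧ p ∈ ({z}ᶜ : Set X) :=
      nonempty_of_mem (inter_mem (mem_nhdsWithin_of_mem_nhds (hU.mem_nhds hzU))
        (self_mem_nhdsWithin (s := {z}ᶜ)))
    -- Deleting `p` keeps the shell between `U` and `C` nonempty.
    obtain ⟨C, hC, hzC, hCU⟩ := hX.exists_isClopen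
      (O := (U ∩ Metric.ball z (1 / ((n : ℝ) + 1))) \ {p})
      ((hU.inter Metric.isOpen_ball).sdiff isClosed_singleton)
      ⟨⟨hzU, Metric.mem_ball_self (by positivity)⟩, fun h => hpz h.symm⟩
    exact ⟨⟨C, hC.isOpen, hzC⟩, hC.isClosed, fun x hx => (hCU hx).1.1, fun x hx => (hCU hx).1.2,
      p, hpU, fun h => (hCU h).2 rfl⟩
  choose nxt hclosed hsub hball p hpU hpn using step
  let D : ℕ → {U : Set X // IsOpen U ∧ z ∈ U} := fun n => Nat.rec ⟨O, hO, hz⟩ nxt n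
  let C : ℕ → Set X := fun n => (D (n + 1)).1
  have hCopen : ∀ n, IsOpen (C n) := fun n => (D (n + 1)).2.1
  have hCclosed : ∀ n, IsClosed (C n) := fun n => hclosed n (D n)
  have hCanti : Antitone C := antitone_nat_of_succ_le fun n => hsub (n + 1) (D (n + 1))
  have hCO : C 0 ⊆ O := hsub 0 (D 0)
  have hCball : ∀ n, C n ⊆ Metric.ball z (1 / ((n : ℝ) + 1)) := fun n => hball n (D n)
  have hex : ∀ x, x ≠ z → ∃ n, x ∉ C n := by
    intro x hx
    obtain ⟨n, hn⟩ := exists_nat_one_div_lt (dist_pos.2 hx)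
    exact ⟨n, fun h => lt_asymm hn (hCball n h)⟩
  -- At `z` the set is empty and the value is the harmless default `0`.
  let g₀ : X → ℕ := fun x => sInf {n | x ∉ C n}
  have hg₀ : ∀ x n, x ∉ C n → (∀ m < n, x ∈ C m) → g₀ x = n := fun x n h1 h2 =>
    le_antisymm (Nat.sInf_le h1) (le_csInf ⟨n, h1⟩ fun m hm => not_lt.1 fun hlt => hm (h2 m hlt))
  have hzero : ∀ x, x ∉ C 0 → g₀ x = 0 := fun x hx => hg₀ x 0 hx fun m hm => by omega
  refine ⟨g₀, ?_, ?_, ?_⟩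
  · intro x hx
    have h1 : x ∉ C (g₀ x) := Nat.sInf_mem (s := {n | x ∉ C n}) (hex x hx)
    have h2 : ∀ m < g₀ x, x ∈ C m := fun m hm => not_not.1 fun h => Nat.notMem_of_lt_sInf hm h
    have h3 : ∀ᶠ y in 𝓝 x, ∀ m ∈ Finset.range (g₀ x), y ∈ C m :=
      (Finset.eventually_all _).2 fun m hm =>
        (hCopen m).mem_nhds (h2 m (Finset.mem_range.1 hm))
    filter_upwards [(hCclosed _).isOpen_compl.mem_nhds h1, h3] with y hy1 hy2
    rw [hg₀ y _ hy1 fun m hm => hy2 m (Finset.mem_range.2 hm)]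
  · intro x hx
    exact hzero x fun h => hx (hCO h)
  · intro r hr
    obtain ⟨n, hn⟩ := exists_nat_one_div_lt hr
    filter_upwards [eventually_ge_atTop (n + 1)] with m hm
    obtain ⟨k, rfl⟩ := Nat.exists_eq_add_of_le' (show 1 ≤ m by omega)
    have hp1 : p (k + 1) (D (k + 1)) ∈ C k := hpU (k + 1) (D (k + 1))
    have hp2 : p (k + 1) (D (k + 1)) ∉ C (k + 1) := hpn (k + 1) (D (k + 1))
    refine ⟨p (k + 1) (D (k + 1)), ?_, fun h => ?_, ?_⟩
    · exact (hCball n (hCanti (by omega) hp1)).trans hn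
    · rw [h] at hp2
      exact hp2 (D (k + 2)).2.2
    · exact hg₀ _ (k + 1) hp2 fun m hm => hCanti (by omega) hp1

theorem exists_maximal_separated {X : Type u} [MetricSpace X] (V : Set X) {ε : ℝ} (hε : 0 < ε) :
    ∃ Z ⊆ V, Z.Pairwise (fun x y => ε ≤ dist x y) ∧ ∀ x ∈ V, ∃ z ∈ Z, dist x z < ε := by
  obtain ⟨Z, hZ⟩ := zorn_subset {S : Set X | S ⊆ V ∧ S.Pairwise fun x y => ε ≤ dist x y} (by
    intro c hc hch
    refine ⟨⋃₀ c, ⟨sUnion_subset fun s hs => (hc hs).1, ?_⟩, fun s hs => subset_sUnion_of_mem hs⟩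
    exact (pairwise_sUnion hch.directedOn).2 fun s hs => (hc hs).2)
  refine ⟨Z, hZ.prop.1, hZ.prop.2, fun x hx => ?_⟩
  by_contra! hfar
  have hxZ : x ∈ Z := by
    refine hZ.le_of_ge (y := insert x Z) ⟨insert_subset hx hZ.prop.1, ?_⟩ (subset_insert x Z)
      (mem_insert x Z)
    exact hZ.prop.2.insert fun y hy _ => ⟨hfar y hy, dist_comm x y ▸ hfar y hy⟩
  have := hfar x hxZ
  rw [dist_self] at this
  exact absurd this (not_le.2 hε)

/-- An open set `V` splits into an `ε`-dense closed discrete subset `Z` and countably many open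
pieces, which come arbitrarily close to every point of `Z`. -/
theorem ZeroDimensionalSpace.exists_splitting {X : Type u} [MetricSpace X]
    (hX : ZeroDimensionalSpace X) (hd : DenseInItself X) {V : Set X} (hV : IsOpen V) {ε : ℝ}
    (hε : 0 < ε) :
    ∃ (Z : Set X) (c : X → ℕ), Z ⊆ V ∧ (∀ S ⊆ Z, IsClosed S) ∧
      (∀ j, IsOpen {x | x ∈ V ∧ x ∉ Z ∧ c x = j}) ∧ (∀ x ∈ V, ∃ z ∈ Z, dist x z < ε) ∧
      ∀ z ∈ Z, ∀ r > 0, ∀ᶠ k in atTop, ∃ x, dist x z < r ∧ x ∈ V ∧ x ∉ Z ∧ c x = k := by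
  classical
  obtain ⟨Z, hZV, hZsep, hZdense⟩ := exists_maximal_separated V hε
  have hZclosed : ∀ S ⊆ Z, IsClosed S := fun S hS =>
    Metric.isClosed_of_pairwise_le_dist hε (hZsep.mono hS)
  -- The `ε / 2`-balls around `Z` are disjoint. Shells confined to radius `ε / 4` leave a collar
  -- where `c` vanishes, so `c` is locally constant off `Z`.
  have hshell := fun z : X => hX.exists_shells hd (z := z) (O := Metric.ball z (ε / 4))
    Metric.isOpen_ball (Metric.mem_ball_self (by positivity))
  choose g hgloc hgzero hgnear using hshell
  let c : X → ℕ := fun x => if h : ∃ z ∈ Z, dist x z < ε / 2 then g h.choose x else 0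
  have huniq : ∀ x, ∀ z ∈ Z, ∀ z' ∈ Z, dist x z < ε / 2 → dist x z' < ε / 2 → z = z' := by
    intro x z hz z' hz' h h'
    by_contra hne
    have := hZsep hz hz' hne
    have := dist_triangle_left z z' x
    linarith
  have hc : ∀ x, ∀ z ∈ Z, dist x z < ε / 2 → c x = g z x := by
    intro x z hz hxz
    have h : ∃ z ∈ Z, dist x z < ε / 2 := ⟨z, hz, hxz⟩
    simp only [c, dif_pos h]
    rw [huniq x _ h.choose_spec.1 z hz h.choose_spec.2 hxz]
  have hc0 : ∀ x, (∀ z ∈ Z, ε / 4 ≤ dist x z) → c x = 0 := by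
    intro x hx
    by_cases h : ∃ z ∈ Z, dist x z < ε / 2
    · obtain ⟨z, hz, hxz⟩ := h
      rw [hc x z hz hxz]
      exact hgzero z x (by simpa using hx z hz)
    · simp only [c, dif_neg h]
  have hcloc : ∀ x ∉ Z, ∀ᶠ y in 𝓝 x, c y = c x := by
    intro x hx
    by_cases h : ∃ z ∈ Z, dist x z < ε / 2
    · obtain ⟨z, hz, hxz⟩ := h
      filter_upwards [hgloc z x (fun h => hx (h ▸ hz)), Metric.isOpen_ball.mem_nhds hxz]
        with y hy hyz
      rw [hc y z hz hyz, hc x z hz hxz, hy]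
    · push Not at h
      filter_upwards [Metric.ball_mem_nhds x (show 0 < ε / 4 by positivity)] with y hy
      rw [hc0 x fun z hz => by linarith [h z hz], hc0 y fun z hz => ?_]
      have := dist_triangle_left x z y
      have := h z hz
      rw [Metric.mem_ball] at hy
      linarith
  refine ⟨Z, c, hZV, hZclosed, fun j => ?_, hZdense, fun z hz r hr => ?_⟩
  · rw [isOpen_iff_mem_nhds]
    rintro x ⟨hxV, hxZ, hxj⟩
    filter_upwards [hV.mem_nhds hxV, (hZclosed Z Subset.rfl).isOpen_compl.mem_nhds hxZ,
      hcloc x hxZ] with y h1 h2 h3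
    exact ⟨h1, h2, h3.trans hxj⟩
  · obtain ⟨s, hs, hsV⟩ := Metric.isOpen_iff.1 hV z (hZV hz)
    filter_upwards [hgnear z (min (min s r) (ε / 2)) (by positivity)] with k hk
    obtain ⟨x, hxd, hxz, hxk⟩ := hk
    rw [lt_min_iff, lt_min_iff] at hxd
    refine ⟨x, hxd.1.2, hsV hxd.1.1, fun hxZ => ?_, (hc x z hz hxd.2).trans hxk⟩
    linarith [hZsep hxZ hz hxz]

/-- A noncompact zero-dimensional metric space splits into infinitely many nonempty open sets. -/
theorem ZeroDimensionalSpace.exists_continuous_surjective_nat {X : Type u} [MetricSpace X]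
    (hX : ZeroDimensionalSpace X) (hnc : ¬ CompactSpace X) :
    ∃ c : X → ℕ, Continuous c ∧ Function.Surjective c := by
  obtain ⟨u, hu⟩ : ∃ u : ℕ → X, ∀ x, ¬ MapClusterPt x atTop u := by
    by_contra! h
    refine hnc ?_
    refine compactSpace_iff_seqCompactSpace.2 ⟨?_⟩
    intro u _
    obtain ⟨x, hx⟩ := h u
    obtain ⟨ψ, hψ, hlim⟩ := hx.tendsto_subseq
    exact ⟨x, mem_univ x, ψ, hψ, hlim⟩
  have hC := fun n : ℕ => hX.exists_isClopen (z := u n) (O := Metric.ball (u n) (1 / ((n : ℝ) + 1)))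
    Metric.isOpen_ball (Metric.mem_ball_self (by positivity))
  choose C hCclopen hCmem hCball using hC
  -- `u` has no cluster point and the radii tend to zero.
  have hlf : LocallyFinite C := by
    intro x
    have hx := hu x
    rw [mapClusterPt_iff_frequently] at hx
    push Not at hx
    obtain ⟨s, hs, hsu⟩ := hx
    obtain ⟨r, hr, hrs⟩ := Metric.mem_nhds_iff.1 hs
    refine ⟨Metric.ball x (r / 2), Metric.ball_mem_nhds x (half_pos hr), ?_⟩
    rw [← Nat.cofinite_eq_atTop] at hsu
    have h1 : ∀ᶠ n : ℕ in cofinite, 1 / ((n : ℝ) + 1) < r / 2 := by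
      rw [Nat.cofinite_eq_atTop]
      exact tendsto_one_div_add_atTop_nhds_zero_nat.eventually (gt_mem_nhds (half_pos hr))
    refine (hsu.and h1).mono (q := fun n => ¬ (C n ∩ Metric.ball x (r / 2)).Nonempty) ?_ |>.subset
      fun n hn => not_not.2 hn
    rintro n ⟨hn, hnr⟩ ⟨y, hyC, hyx⟩
    refine hn (hrs ?_)
    have h2 := hCball n hyC
    have h3 := dist_triangle_left (u n) x y
    rw [Metric.mem_ball] at *
    linarith
  let f : ℕ → X → ℕ := fun n => (C n).indicator fun _ => n
  have hflf : LocallyFinite fun n => Function.support (f n) :=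
    hlf.subset fun n => support_indicator_subset
  let c : X → ℕ := fun x => ∑ᶠ n, f n x
  have hc : Continuous c :=
    continuous_finsum (fun n => continuous_const.indicator (by simp [(hCclopen n).frontier_eq]))
      hflf
  have hcu : ∀ n, n ≤ c (u n) := fun n =>
    calc n = f n (u n) := (indicator_of_mem (hCmem n) fun _ => n).symm
      _ ≤ c (u n) := single_le_finsum n (hflf.point_finite (u n)) fun j => Nat.zero_le _
  have : Infinite (range c) := infinite_coe_iff.2 <| infinite_of_forall_exists_gt fun n =>
    ⟨c (u (n + 1)), mem_range_self _, hcu (n + 1)⟩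
  obtain ⟨e⟩ := nonempty_equiv_of_countable (α := range c) (β := ℕ)
  exact ⟨fun x => e ⟨c x, mem_range_self x⟩,
    (continuous_of_discreteTopology (f := e)).comp (hc.subtype_mk _),
    e.surjective.comp fun ⟨_, x, hx⟩ => ⟨x, Subtype.ext hx⟩⟩

/-! ### Labelling an open set by a frame -/

/-- Let `W` be a transitive serial frame of sets of formulas in which failures of `box φ` are
witnessed and sequences have limits. Every open subset of a zero-dimensional dense-in-itself metric
space maps to `W` so that `box` is interpreted as the coderivative, with a given root `t`. -/
theorem ZeroDimensionalSpace.exists_valued_map {X : Type u} [MetricSpace X]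
    (hX : ZeroDimensionalSpace X) (hd : DenseInItself X) {W F : Type*} [Countable F] [Nonempty F]
    (sat : W → F → Prop) (box : F → F) (R : W → W → Prop)
    (hR : ∀ t u, R t u ↔ ∀ φ, sat t (box φ) → sat u φ)
    (htrans : ∀ t φ, sat t (box φ) → sat t (box (box φ)))
    (hser : ∀ t, ∃ u, R t u)
    (hwit : ∀ t φ, ¬ sat t (box φ) → ∃ u, R t u ∧ ¬ sat u φ)
    (hlim : ∀ s : ℕ → W, ∃ u, ∀ φ, ((∀ᶠ n in atTop, sat (s n) φ) → sat u φ) ∧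
      (sat u φ → ∃ᶠ n in atTop, sat (s n) φ))
    {V : Set X} (hV : IsOpen V) (t : W) :
    ∃ f : X → W, (V.Nonempty → ∃ x ∈ V, f x = t) ∧ (∀ x ∈ V, f x = t ∨ R t (f x)) ∧
      ∀ x ∈ V, ∀ φ, sat (f x) (box φ) ↔ ∀ᶠ y in 𝓝[≠] x, sat (f y) φ := by
  classical
  have hRtrans : ∀ {a b c}, R a b → R b c → R a c := by
    intro a b c hab hbc
    rw [hR] at *
    exact fun φ h => hbc φ (hab _ (htrans a φ h))
  have hsucc : ∀ t, ∃ s : ℕ → W, (∀ j, R t (s j)) ∧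
      ∀ φ, ¬ sat t (box φ) → ∃ j, ¬ sat (s j) φ := by
    intro t
    obtain ⟨e, he⟩ := exists_surjective_nat F
    have : ∀ j, ∃ u, R t u ∧ (¬ sat t (box (e j)) → ¬ sat u (e j)) := by
      intro j
      by_cases h : sat t (box (e j))
      · obtain ⟨u, hu⟩ := hser t
        exact ⟨u, hu, fun h' => (h' h).elim⟩
      · obtain ⟨u, hu, hu'⟩ := hwit t _ h
        exact ⟨u, hu, fun _ => hu'⟩
    choose s hs hs' using this
    refine ⟨s, hs, fun φ h => ?_⟩
    obtain ⟨j, rfl⟩ := he φ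
    exact ⟨j, hs' j h⟩
  choose succ hsuccR hsuccwit using hsucc
  have hsplit := fun (m : ℕ) (U : Opens X) =>
    hX.exists_splitting hd U.isOpen (Nat.one_div_pos_of_nat (α := ℝ) (n := m))
  choose Z c hZU hZcl hopen hdense hnear using hsplit
  -- Through `unpair`, every successor labels infinitely many pieces. The scale index grows with
  -- both the depth `n` and the piece number `k`.
  let next : ℕ → Opens X × W × ℕ → ℕ → Opens X × W × ℕ := fun n s k =>
    (⟨_, hopen s.2.2 s.1 k⟩, succ s.2.1 k.unpair.1, n + 1 + k)
  let st : ℕ → X → Opens X × W × ℕ := fun n x => Nat.rec (⟨V, hV⟩, t, 0)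
    (fun n s => next n s (c s.2.2 s.1 x)) n
  let U : ℕ → X → Opens X := fun n x => (st n x).1
  let T : ℕ → X → W := fun n x => (st n x).2.1
  let M : ℕ → X → ℕ := fun n x => (st n x).2.2
  let D : ℕ → X → Set X := fun n x => Z (M n x) (U n x)
  let K : ℕ → X → X → ℕ := fun n x => c (M n x) (U n x)
  have hU : ∀ n x y, y ∈ U (n + 1) x ↔ y ∈ U n x ∧ y ∉ D n x ∧ K n x y = K n x x :=
    fun n x y => Iff.rfl
  have hM : ∀ n x, n ≤ M n x
    | 0, _ => Nat.zero_le _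
    | n + 1, x => Nat.le_add_right (n + 1) (K n x x)
  have hUle : ∀ x, Antitone fun n => U n x :=
    fun x => antitone_nat_of_succ_le fun n y hy => ((hU n x y).1 hy).1
  have hst : ∀ n x y, y ∈ U n x → st n y = st n x := by
    intro n x y
    induction n with
    | zero => exact fun _ => rfl
    | succ n ih =>
      intro hy
      obtain ⟨h1, h2, h3⟩ := (hU n x y).1 hy
      have h4 := ih h1
      change next n (st n y) (c (st n y).2.2 (st n y).1 y) = next n (st n x) (K n x x)
      rw [h4]
      exact congrArg _ h3
  have hUeq : ∀ n x y, y ∈ U n x → U n y = U n x := fun n x y h => congrArg Prod.fst (hst n x y h)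
  have hTeq : ∀ n x y, y ∈ U n x → T n y = T n x := fun n x y h =>
    congrArg (fun s => s.2.1) (hst n x y h)
  have hDeq : ∀ n x y, y ∈ U n x → D n y = D n x := fun n x y h =>
    congrArg (fun s => Z s.2.2 s.1) (hst n x y h)
  have hUself : ∀ n x y, y ∈ U n x → y ∈ U n y := fun n x y h => (hUeq n x y h).symm ▸ h
  have hUsucc : ∀ n x, x ∈ U n x → x ∉ D n x → x ∈ U (n + 1) x := fun n x h h' =>
    (hU n x x).2 ⟨h, h', rfl⟩
  have hTR : ∀ n x, R (T n x) (T (n + 1) x) := fun n x => hsuccR _ _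
  have hTlt : ∀ x n k, R (T n x) (T (n + 1 + k) x) := by
    intro x n k
    induction k with
    | zero => exact hTR n x
    | succ k ih => exact hRtrans ih (hTR _ x)
  have hlimR : ∀ x, ∃ u, (∀ n, R (T n x) u) ∧
      ∀ φ, sat u (box φ) → ∃ n, sat (T n x) (box φ) := by
    intro x
    obtain ⟨u, hu⟩ := hlim fun n => T n x
    refine ⟨u, fun n => (hR _ _).2 fun φ h => (hu φ).1 ?_, fun φ h => ((hu _).2 h).exists⟩
    filter_upwards [eventually_ge_atTop (n + 1)] with m hm
    obtain ⟨k, rfl⟩ := Nat.exists_eq_add_of_le hm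
    exact (hR _ _).1 (hTlt x n k) φ h
  choose l hlR hlbox using hlimR
  let f : X → W := fun x => if h : ∃ n, x ∈ D n x then T h.choose x else l x
  have hZlt : ∀ x n m, x ∈ D n x → x ∈ U m x → m ≤ n := by
    intro x n m hn hm
    by_contra! h
    exact ((hU n x x).1 (hUle x h hm)).2.1 hn
  have hfZ : ∀ x n, x ∈ D n x → f x = T n x := by
    intro x n hn
    have h : ∃ n, x ∈ D n x := ⟨n, hn⟩
    have h1 := hZlt x n _ hn (hZU _ _ h.choose_spec)
    have h2 := hZlt x _ n h.choose_spec (hZU _ _ hn)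
    simp only [f, dif_pos h, le_antisymm h1 h2]
  have hfT : ∀ n x, x ∈ U n x → f x = T n x ∨ R (T n x) (f x) := by
    intro n x hx
    by_cases h : ∃ m, x ∈ D m x
    · obtain ⟨m, hm⟩ := h
      rw [hfZ x m hm]
      obtain h | h := (hZlt x m n hm hx).eq_or_lt
      · exact .inl (h ▸ rfl)
      · obtain ⟨k, rfl⟩ := Nat.exists_eq_add_of_le h
        exact .inr (hTlt x n k)
    · simp only [f, dif_neg h]
      exact .inr (hlR x n)
  have hfsucc : ∀ n x, x ∈ U (n + 1) x → R (T n x) (f x) := by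
    intro n x hx
    obtain h | h := hfT (n + 1) x hx
    · exact h ▸ hTR n x
    · exact hRtrans (hTR n x) h
  -- A piece with large number and label `succ _ j` comes within `r / 2` of `z`, and its own net is
  -- finer than `r / 2`; so a net point `w` refuting `φ` lies within `r` of `z`.
  have hcenter : ∀ n x z φ, z ∈ D n x → ¬ sat (T n x) (box φ) →
      ∃ᶠ y in 𝓝 z, y ≠ z ∧ ¬ sat (f y) φ := by
    intro n x z φ hz hφ
    obtain ⟨j, hj⟩ := hsuccwit _ φ hφ
    rw [Metric.nhds_basis_ball.frequently_iff]
    intro r hr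
    obtain ⟨m, hm⟩ := exists_nat_one_div_lt (half_pos hr)
    obtain ⟨N, hN⟩ := eventually_atTop.1 (hnear _ _ z hz (r / 2) (half_pos hr))
    obtain ⟨y, hyz, hyU, hyD, hyK⟩ := hN (Nat.pair j (max m N))
      ((le_max_right m N).trans (Nat.right_le_pair _ _))
    have hst' : st (n + 1) y = next n (st n x) (Nat.pair j (max m N)) := by
      change next n (st n y) (c (st n y).2.2 (st n y).1 y) = _
      rw [hst n x y hyU]
      exact congrArg _ hyK
    have hT' : T (n + 1) y = succ (T n x) j := by
      change (st (n + 1) y).2.1 = _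
      rw [hst']
      simp only [next, Nat.unpair_pair]
      rfl
    have hM' : m ≤ M (n + 1) y := by
      change m ≤ (st (n + 1) y).2.2
      rw [hst']
      have := Nat.right_le_pair j (max m N)
      simp only [next]
      omega
    have hyU' : y ∈ U (n + 1) y :=
      hUsucc n y (hUself n x y hyU) ((hDeq n x y hyU).symm ▸ hyD)
    obtain ⟨w, hw, hwy⟩ := hdense _ _ y hyU'
    have hwU : w ∈ U (n + 1) y := hZU _ _ hw
    have hwD : w ∈ D (n + 1) w := (hDeq (n + 1) y w hwU).symm ▸ hw
    refine ⟨w, ?_, fun h => ?_, ?_⟩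
    · have h1 := dist_triangle_left w z y
      have h2 := (hwy.trans_le (Nat.one_div_le_one_div hM')).trans hm
      rw [Metric.mem_ball]
      linarith
    · exact ((hU n y w).1 hwU).2.1 (by rw [h, hDeq n x y hyU]; exact hz)
    · rw [hfZ w (n + 1) hwD, hTeq (n + 1) y w hwU, hT']
      exact hj
  refine ⟨f, ?_, fun x hx => hfT 0 x hx, fun x hx φ => ?_⟩
  · rintro ⟨x, hx⟩
    obtain ⟨z, hz, -⟩ := hdense _ (U 0 x) x hx
    exact ⟨z, hZU _ _ hz, hfZ z 0 hz⟩
  by_cases hxZ : ∃ n, x ∈ D n x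
  · obtain ⟨n, hn⟩ := hxZ
    rw [hfZ x n hn]
    constructor
    · intro h
      -- Every subset of the net is closed, so points near `x` other than `x` fall into subcells.
      have hO : ∀ᶠ y in 𝓝 x, y ∈ U n x ∧ y ∉ D n x \ {x} :=
        ((U n x).isOpen.eventually_mem (hZU _ _ hn)).and
          ((hZcl (M n x) (U n x) (D n x \ {x}) sdiff_subset).isOpen_compl.eventually_mem
            fun h => h.2 rfl)
      filter_upwards [self_mem_nhdsWithin, mem_nhdsWithin_of_mem_nhds hO] with y hyx hy
      have hy' : y ∈ U (n + 1) y :=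
        hUsucc n y (hUself n x y hy.1) ((hDeq n x y hy.1).symm ▸ fun h => hy.2 ⟨h, hyx⟩)
      exact (hR _ _).1 (hfsucc n y hy') φ (hTeq n x y hy.1 ▸ h)
    · intro h
      by_contra hφ
      refine hcenter n x x φ hn hφ ?_
      filter_upwards [eventually_nhdsWithin_iff.1 h] with y hy hy'
      exact hy'.2 (hy hy'.1)
  · have hfl : f x = l x := dif_neg hxZ
    push Not at hxZ
    have hxU : ∀ n, x ∈ U n x := by
      intro n
      induction n with
      | zero => exact hx
      | succ n ih => exact hUsucc n x ih (hxZ n)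
    rw [hfl]
    constructor
    · intro h
      obtain ⟨n, hn⟩ := hlbox x φ h
      refine eventually_nhdsWithin_of_eventually_nhds ?_
      filter_upwards [(U (n + 1) x).isOpen.mem_nhds (hxU (n + 1))] with y hy
      exact (hR _ _).1 (hfsucc n y (hUself (n + 1) x y hy)) φ
        (hTeq n x y (hUle x (Nat.le_succ n) hy) ▸ hn)
    · intro h
      by_contra hφ
      -- `box φ` thus fails in all cells around `x`, whose net points approach `x` and are limits of
      -- points refuting `φ`.
      have hφ' : ∀ n, ¬ sat (T n x) (box φ) := fun n hn =>
        hφ ((hR _ _).1 (hlR x n) _ (htrans _ _ hn))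
      obtain ⟨r, hr, hball⟩ := Metric.eventually_nhds_iff_ball.1 (eventually_nhdsWithin_iff.1 h)
      obtain ⟨n, hn⟩ := exists_nat_one_div_lt hr
      obtain ⟨z, hz, hxz⟩ := hdense _ (U n x) x (hxU n)
      have hzx : z ≠ x := by
        rintro rfl
        exact hxZ n hz
      have hzr : z ∈ Metric.ball x r := by
        rw [Metric.mem_ball, dist_comm]
        exact (hxz.trans_le (Nat.one_div_le_one_div (hM n x))).trans hn
      obtain ⟨y, ⟨-, hy⟩, hyr, hyx⟩ := ((hcenter n x z φ hz (hφ' n)).and_eventually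
        ((Metric.isOpen_ball.eventually_mem hzr).and (isOpen_ne.eventually_mem hzx))).exists
      exact hy (hball y hyr hyx)

/-! ### The canonical frame of ultrafilters -/

namespace ModalFormula

/-- An injective coding of formulas by natural numbers. -/
def code : ModalFormula → ℕ
  | var p => 6 * p
  | top => 1
  | neg φ => 6 * code φ + 2
  | and φ ψ => 6 * Nat.pair (code φ) (code ψ) + 3
  | coderiv φ => 6 * code φ + 4
  | univ φ => 6 * code φ + 5

theorem code_injective : Function.Injective code := by
  intro φ
  induction φ with
  | and φ ψ ih ih' =>
    intro χ h
    cases χ <;> simp only [code] at h <;> try omega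
    obtain ⟨h1, h2⟩ := Nat.pair_eq_pair.1 (Nat.eq_of_mul_eq_mul_left (by norm_num) (Nat.add_right_cancel h))
    rw [ih h1, ih' h2]
  | var p =>
    intro χ h
    cases χ <;> simp only [code] at h <;> try omega
    congr 1
    omega
  | top =>
    intro χ h
    cases χ <;> simp only [code] at h <;> first | rfl | omega
  | neg φ ih | coderiv φ ih | univ φ ih =>
    intro χ h
    cases χ <;> simp only [code] at h <;> try omega
    rw [ih (Nat.eq_of_mul_eq_mul_left (by norm_num) (Nat.add_right_cancel h))]

instance : Countable ModalFormula := code_injective.countable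

instance : Nonempty ModalFormula := ⟨top⟩

variable {X : Type u} [TopologicalSpace X]

theorem trueAt_coderiv (h : ℕ → Set X) (φ : ModalFormula) (x : X) :
    TrueAt h (coderiv φ) x ↔ ∀ᶠ y in 𝓝[≠] x, TrueAt h φ y := by
  rw [eventually_nhdsWithin_iff, eventually_nhds_iff]
  constructor
  · rintro ⟨O, hO, hx, h⟩
    exact ⟨O, fun y hy hyx => h y ⟨hy, hyx⟩, hO, hx⟩
  · rintro ⟨O, h, hO, hx⟩
    exact ⟨O, hO, hx, fun y hy => h y hy.1 hy.2⟩

theorem TrueAt.coderiv_coderiv [T1Space X] {h : ℕ → Set X} {φ : ModalFormula} {x : X}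
    (hx : TrueAt h (coderiv φ) x) : TrueAt h (coderiv (coderiv φ)) x := by
  obtain ⟨O, hO, hxO, hφ⟩ := hx
  exact ⟨O, hO, hxO, fun y hy => ⟨O \ {x}, hO.sdiff isClosed_singleton, hy, fun z hz => hφ z hz.1⟩⟩

/-- Ultrafilters on the pointed models over `X`. They induce the maximal sets of formulas which
are finitely satisfiable in `X`. -/
abbrev PointedUltrafilter (X : Type u) : Type u :=
  Ultrafilter ((ℕ → Set X) × X)

/-- The formula `φ` holds in almost all pointed models. -/
def PointedUltrafilter.Sat (t : PointedUltrafilter X) (φ : ModalFormula) : Prop :=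
  ∀ᶠ m in (t : Filter ((ℕ → Set X) × X)), TrueAt m.1 φ m.2

namespace PointedUltrafilter

/-- The accessibility relation of the coderivative operator on maximal sets of formulas. -/
def Rel (t u : PointedUltrafilter X) : Prop :=
  ∀ φ, t.Sat (coderiv φ) → u.Sat φ

variable (t u : PointedUltrafilter X) (φ ψ : ModalFormula)

theorem sat_top : t.Sat top := Eventually.of_forall fun _ => trivial

theorem sat_neg : t.Sat (neg φ) ↔ ¬ t.Sat φ :=
  Ultrafilter.eventually_not

theorem sat_and : t.Sat (and φ ψ) ↔ t.Sat φ ∧ t.Sat ψ :=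
  eventually_and

variable {t u φ ψ}

theorem Sat.mono (h : ∀ (g : ℕ → Set X) x, TrueAt g φ x → TrueAt g ψ x) (ht : t.Sat φ) : t.Sat ψ :=
  Eventually.mono ht fun m => h m.1 m.2

theorem Sat.of_univ (h : t.Sat (univ φ)) : t.Sat φ :=
  Sat.mono (φ := univ φ) (fun _ x hx => hx x) h

/-- In any model `univ φ` and its negation are constant, so each implies its own `coderiv`. -/
theorem Rel.sat_univ_iff (h : t.Rel u) : u.Sat (univ φ) ↔ t.Sat (univ φ) := by
  refine ⟨fun hu => ?_, fun ht => h _ (ht.mono fun g x hx => ?_)⟩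
  · by_contra ht
    refine (sat_neg u _).1 (h (neg (univ φ)) (((sat_neg t _).2 ht).mono fun g x hx => ?_)) hu
    exact ⟨Set.univ, isOpen_univ, mem_univ x, fun _ _ => hx⟩
  · exact ⟨Set.univ, isOpen_univ, mem_univ x, fun _ _ => hx⟩

/-- The filter of sets of pointed models which contain, for almost all `(h, x)`, the models
`(h, y)` for all `y ≠ x` close to `x`. -/
def puncturedNhds (t : PointedUltrafilter X) : Filter ((ℕ → Set X) × X) :=
  (t : Filter ((ℕ → Set X) × X)).bind fun m => (𝓝[≠] m.2).map (Prod.mk m.1)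

theorem eventually_puncturedNhds :
    (∀ᶠ m in t.puncturedNhds, TrueAt m.1 φ m.2) ↔ t.Sat (coderiv φ) := by
  simp only [puncturedNhds, eventually_bind, eventually_map, Sat, trueAt_coderiv]

theorem rel_of_le (h : (u : Filter ((ℕ → Set X) × X)) ≤ t.puncturedNhds) : t.Rel u :=
  fun _ hφ => (eventually_puncturedNhds.2 hφ).filter_mono h

/-- A set outside a filter is missed by some finer ultrafilter; here the filter is `puncturedNhds`.
-/
theorem exists_rel_not_sat (h : ¬ t.Sat (coderiv φ)) : ∃ u : PointedUltrafilter X,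
    t.Rel u ∧ ¬ u.Sat φ := by
  rw [← eventually_puncturedNhds, Filter.Eventually, mem_iff_ultrafilter] at h
  push Not at h
  obtain ⟨u, hu, hφ⟩ := h
  exact ⟨u, rel_of_le hu, hφ⟩

theorem exists_rel (hd : DenseInItself X) (t : PointedUltrafilter X) :
    ∃ u : PointedUltrafilter X, t.Rel u := by
  obtain ⟨u, hu, -⟩ := exists_rel_not_sat (t := t) (φ := neg top) fun h => by
    obtain ⟨m, hm⟩ := Eventually.exists h
    rw [trueAt_coderiv] at hm
    have := hd.neBot m.2
    obtain ⟨y, hy⟩ := hm.exists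
    exact hy trivial
  exact ⟨u, hu⟩

theorem exists_not_sat_of_not_sat_univ (h : ¬ t.Sat (univ φ)) : ∃ u : PointedUltrafilter X,
    (∀ ψ, u.Sat (univ ψ) ↔ t.Sat (univ ψ)) ∧ ¬ u.Sat φ := by
  -- Keeps the assignment and lets the point range over all of `X`.
  let G : Filter ((ℕ → Set X) × X) :=
    (t : Filter ((ℕ → Set X) × X)).bind fun m => (⊤ : Filter X).map (Prod.mk m.1)
  have hG : ∀ ψ, (∀ᶠ m in G, TrueAt m.1 ψ m.2) ↔ t.Sat (univ ψ) := fun ψ => by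
    simp only [G, eventually_bind, eventually_map, Sat, eventually_top, TrueAt]
  have h' := h
  rw [← hG, Filter.Eventually, mem_iff_ultrafilter] at h'
  push Not at h'
  obtain ⟨u, hu, hφ⟩ := h'
  refine ⟨u, fun ψ => ⟨fun hψ => ?_, fun hψ => ?_⟩, hφ⟩
  · by_contra hn
    refine (sat_neg u _).1 (((hG (neg (univ ψ))).2 ?_).filter_mono hu) hψ
    exact ((sat_neg t _).2 hn).mono fun g x hx _ => hx
  · exact ((hG (univ ψ)).2 (hψ.mono fun g x hx _ => hx)).filter_mono hu

theorem exists_limit (s : ℕ → PointedUltrafilter X) : ∃ u : PointedUltrafilter X, ∀ φ,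
    ((∀ᶠ n in atTop, (s n).Sat φ) → u.Sat φ) ∧ (u.Sat φ → ∃ᶠ n in atTop, (s n).Sat φ) := by
  let u : PointedUltrafilter X := Ultrafilter.bind (hyperfilter ℕ) s
  have hu : ∀ φ, u.Sat φ ↔ ∀ᶠ n in (hyperfilter ℕ : Filter ℕ), (s n).Sat φ := fun φ => Iff.rfl
  refine ⟨u, fun φ => ⟨fun h => ?_, fun h => ?_⟩⟩
  · exact (hu φ).2 (h.filter_mono Nat.hyperfilter_le_atTop)
  · exact ((hu φ).1 h).frequently.filter_mono Nat.hyperfilter_le_atTop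

end PointedUltrafilter

theorem FinitelySatisfiable.exists_pointedUltrafilter {Γ : Set ModalFormula}
    (hΓ : FinitelySatisfiable X Γ) : ∃ t : PointedUltrafilter X, ∀ φ ∈ Γ, t.Sat φ := by
  let G : Filter ((ℕ → Set X) × X) :=
    generate ((fun φ => {m : (ℕ → Set X) × X | TrueAt m.1 φ m.2}) '' Γ)
  have : G.NeBot := by
    rw [generate_neBot_iff]
    intro S hS hfin
    obtain ⟨Δ, hΔ, hΔfin, rfl⟩ := exists_subset_image_finite_and.1 ⟨S, hS, hfin, rfl⟩
    obtain ⟨h, x, hx⟩ := hΓ Δ hΔ hΔfin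
    exact ⟨(h, x), by simpa using hx⟩
  exact ⟨Ultrafilter.of G, fun φ hφ =>
    Ultrafilter.of_le G (mem_generate_of_mem (mem_image_of_mem _ hφ))⟩

end ModalFormula

/-! ### Assembling the model -/

open ModalFormula in
theorem mainTheorem4 (X : Type u) [MetricSpace X] (hzero : ZeroDimensionalSpace X)
    (hdense : DenseInItself X) (hnoncompact : ¬ CompactSpace X) :
    ModalFormula.LanguageCompactOver X := by
  intro Γ hΓ
  obtain ⟨t, ht⟩ := hΓ.exists_pointedUltrafilter
  obtain ⟨c, hc, hcsurj⟩ := hzero.exists_continuous_surjective_nat hnoncompact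
  have hs : ∃ s : ℕ → PointedUltrafilter X, (∃ j, s j = t) ∧
      (∀ j φ, (s j).Sat (univ φ) ↔ t.Sat (univ φ)) ∧
      ∀ φ, ¬ t.Sat (univ φ) → ∃ j, ¬ (s j).Sat φ := by
    -- `none` reserves a piece for `t` itself.
    obtain ⟨e, he⟩ := exists_surjective_nat (Option ModalFormula)
    have : ∀ o : Option ModalFormula, ∃ u : PointedUltrafilter X,
        (∀ φ, u.Sat (univ φ) ↔ t.Sat (univ φ)) ∧ (o = none → u = t) ∧
        ∀ φ, o = some φ → ¬ t.Sat (univ φ) → ¬ u.Sat φ := by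
      rintro (_ | φ)
      · exact ⟨t, fun _ => Iff.rfl, fun _ => rfl, by simp⟩
      · by_cases h : t.Sat (univ φ)
        · exact ⟨t, fun _ => Iff.rfl, fun _ => rfl, by rintro _ ⟨⟩ h'; exact (h' h).elim⟩
        · obtain ⟨u, hu, hφ⟩ := PointedUltrafilter.exists_not_sat_of_not_sat_univ h
          exact ⟨u, hu, by simp, by rintro _ ⟨⟩ _; exact hφ⟩
    choose u hu hnone hsome using this
    refine ⟨u ∘ e, ?_, fun j => hu (e j), fun φ hφ => ?_⟩
    · obtain ⟨j, hj⟩ := he none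
      exact ⟨j, hnone _ hj⟩
    · obtain ⟨j, hj⟩ := he (some φ)
      exact ⟨j, hsome _ φ hj hφ⟩
  obtain ⟨s, ⟨j₀, hj₀⟩, hsuniv, hswit⟩ := hs
  have := hzero.1
  have hmap := fun j => hzero.exists_valued_map hdense (W := PointedUltrafilter X)
    PointedUltrafilter.Sat coderiv PointedUltrafilter.Rel (fun _ _ => Iff.rfl)
    (fun _ _ h => h.mono fun _ _ => TrueAt.coderiv_coderiv)
    (PointedUltrafilter.exists_rel hdense)
    (fun _ _ => PointedUltrafilter.exists_rel_not_sat) PointedUltrafilter.exists_limit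
    ((isOpen_discrete {j}).preimage hc) (s j)
  choose F hF hFrel hFbox using hmap
  let f : X → PointedUltrafilter X := fun x => F (c x) x
  have hfs : ∀ j, ∃ x, f x = s j := by
    intro j
    obtain ⟨x, hx, hxs⟩ := hF j (hcsurj j)
    exact ⟨x, by simpa only [f, show c x = j from hx] using hxs⟩
  have hfuniv : ∀ x φ, (f x).Sat (univ φ) ↔ t.Sat (univ φ) := by
    intro x φ
    rw [← hsuniv (c x) φ]
    obtain h | h := hFrel (c x) x rfl
    · rw [← h]
    · exact h.sat_univ_iff
  have hfbox : ∀ x φ, (f x).Sat (coderiv φ) ↔ ∀ᶠ y in 𝓝[≠] x, (f y).Sat φ := by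
    intro x φ
    refine (hFbox (c x) x rfl φ).trans (eventually_congr ?_)
    filter_upwards [mem_nhdsWithin_of_mem_nhds
      (((isOpen_discrete {c x}).preimage hc).mem_nhds rfl)] with y hy
    simp only [f, show c y = c x from hy]
  have htruth : ∀ φ x, TrueAt (fun p => {x | (f x).Sat (var p)}) φ x ↔ (f x).Sat φ := by
    intro φ
    induction φ with
    | var p => exact fun x => Iff.rfl
    | top => exact fun x => iff_of_true trivial (PointedUltrafilter.sat_top _)
    | neg φ ih => exact fun x => (not_congr (ih x)).trans (PointedUltrafilter.sat_neg _ _).symm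
    | and φ ψ ih ih' =>
      exact fun x => (and_congr (ih x) (ih' x)).trans (PointedUltrafilter.sat_and _ _ _).symm
    | coderiv φ ih =>
      intro x
      rw [trueAt_coderiv, hfbox]
      simp only [ih]
    | univ φ ih =>
      intro x
      simp only [TrueAt, ih]
      refine ⟨fun h => ?_, fun h y => ?_⟩
      · rw [hfuniv]
        by_contra hφ
        obtain ⟨j, hj⟩ := hswit φ hφ
        obtain ⟨y, hy⟩ := hfs j
        exact hj (hy ▸ h y)
      · rw [hfuniv, ← hfuniv y] at h
        exact h.of_univ
  obtain ⟨x, hx⟩ := hfs j₀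
  exact ⟨_, x, fun φ hφ => (htruth φ x).2 (by rw [hx, hj₀]; exact ht φ hφ)⟩
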